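/- Let $\pi$ be a probability measure on the positive integers $\{1,2,3,\dots\}$ whose masses $\pi_i=\pi(\{i\})$ satisfy $\pi_i\ge\pi_{i+1}>0$ for all $i\ge 1$. Let $\xi_1,\xi_2,\dots$ be independent random variables with common law $\pi$, and let $R_n=\#\{\xi_k : 1\le k\le n\}$ be the number of distinct values among the first $n$ of them. For $t\ge 0$ put $$\mu(t)=\sum_{i=1}^\infty\bigl(1-e^{-t\pi_i}\bigr),\qquad \sigma_t=\sqrt{\mu(2t)-\mu(t)}.$$ If $\sigma_n\to\infty$ as $n\to\infty$ (along the positive integers), then $$\frac{R_n-\mu(n)}{\sigma_n}\longrightarrow N(0,1)\quad\text{in distribution as } n\to\infty .$$ -/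

import Mathlib

open MeasureTheory ProbabilityTheory Filter

namespace RangeRenewal

/-- Every set of positive integers is measurable. -/
instance : MeasurableSpace ℕ+ := ⊤

instance : DiscreteMeasurableSpace ℕ+ := ⟨fun _ => trivial⟩

/-- The number of distinct values among the first `n` terms `ξ 0, …, ξ (n - 1)` of the sequence
`ξ` of random variables, at the sample point `ω`. -/
def R {Ω : Type*} (ξ : ℕ → Ω → ℕ+) (n : ℕ) (ω : Ω) : ℕ :=
  ((Finset.range n).image (fun k => ξ k ω)).card

/-- `μ(t) = ∑_{i ≥ 1} (1 - exp (-t π_i))`, where `π_i` is the mass that `π` gives to `i`. -/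
noncomputable def mu (π : Measure ℕ+) (t : ℝ) : ℝ :=
  ∑' i : ℕ+, (1 - Real.exp (-t * π.real {i}))

/-- `σ_t = √(μ(2t) - μ(t))`. -/
noncomputable def sigma (π : Measure ℕ+) (t : ℝ) : ℝ :=
  √(mu π (2 * t) - mu π t)

/-- The series defining `μ(t)` converges for `t ≥ 0`. -/
theorem summable_mu (π : Measure ℕ+) [IsProbabilityMeasure π] {t : ℝ} (ht : 0 ≤ t) :
    Summable (fun i : ℕ+ => 1 - Real.exp (-t * π.real {i})) := by
  have h : Summable (fun i : ℕ+ => π.real {i}) := by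
    have h1 : ∑' i : ℕ+, π {i} ≠ ⊤ := by
      have h2 := lintegral_countable' (μ := π) (fun _ : ℕ+ => 1)
      simp only [lintegral_one, measure_univ, one_mul] at h2
      rw [← h2]
      exact ENNReal.one_ne_top
    exact ENNReal.summable_toReal h1
  refine Summable.of_nonneg_of_le (fun i => ?_) (fun i => ?_) (h.mul_left t)
  · have : 0 ≤ t * π.real {i} := mul_nonneg ht measureReal_nonneg
    have := Real.exp_le_one_iff.2 (show -t * π.real {i} ≤ 0 by linarith)
    linarith
  · have := Real.add_one_le_exp (-t * π.real {i})
    linarith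

end RangeRenewal

namespace RangeRenewal

/-! The proof is Poissonization with characteristic functions. After a Poisson number of draws with
mean `n`, the occurrences of distinct values are independent Bernoulli variables with parameters `1
- exp (-n π_i)`. The number of distinct values then has mean `μ(n)` and variance `σ_n²`. A
third-order Taylor estimate (`norm_bernoulliCharFun_sub_le`) puts its centred characteristic
function at `u` within `2 |u|³ σ_n²` of the Gaussian one, which is `O(1 / σ_n)` for `u = θ / σ_n`.

To return to exactly `n` draws, note that `m` and `n` draws differ in mean count by at most `|m - n|
∑ π_i exp (-3 n π_i / 4)` when both exceed `3 n / 4`. The Poisson fluctuation is of order `√n`, so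
the cost is `|u| √n ∑ π_i exp (-3 n π_i / 4) + 32 / n` (`norm_integral_pow_partialR_sub_prod_le`).
Cauchy–Schwarz (`sqrt_mul_sum_le`) bounds the first term by `|u| σ_n √(depoissonError π n)`, and
`depoissonError` tends to `0`.

All this is done for values in a finite set `S`, so that sums and products are finite; then `S`
increases to `ℕ+`. -/

/-! ### Generating function and moments of the Poisson law. -/

lemma hasSum_of_forall_eq {ι E : Type*} [AddCommMonoid E] [TopologicalSpace E] {f g : ι → E}
    {s : E} (h : HasSum f s) (hfg : ∀ i, g i = f i) : HasSum g s := by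
  rwa [funext hfg]

/-- The mass that the Poisson law with parameter `t` gives to `m`. -/
noncomputable def poissonWeight (t : ℝ) (m : ℕ) : ℝ :=
  Real.exp (-t) * t ^ m / m.factorial

lemma poissonWeight_nonneg {t : ℝ} (ht : 0 ≤ t) (m : ℕ) : 0 ≤ poissonWeight t m := by
  unfold poissonWeight
  positivity

lemma hasSum_poissonWeight_mul_pow (t a : ℝ) :
    HasSum (fun m => poissonWeight t m * a ^ m) (Real.exp (t * (a - 1))) := by
  have h := (NormedSpace.expSeries_div_hasSum_exp (t * a)).mul_left (Real.exp (-t))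
  rw [← Real.exp_eq_exp_ℝ, ← Real.exp_add, show -t + t * a = t * (a - 1) by ring] at h
  refine hasSum_of_forall_eq h fun m => ?_
  rw [poissonWeight, mul_pow]
  ring

lemma hasSum_poissonWeight (t : ℝ) : HasSum (poissonWeight t) 1 := by
  simpa using hasSum_poissonWeight_mul_pow t 1

/-- The factor `m` cancels against `m!` and shifts the index. Applied to `f = 1` and `f m = m`, this
yields the first two moments. -/
lemma hasSum_poissonWeight_mul_cast_mul {t s : ℝ} {f : ℕ → ℝ}
    (h : HasSum (fun m => poissonWeight t m * f (m + 1)) s) :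
    HasSum (fun m : ℕ => poissonWeight t m * (m * f m)) (t * s) := by
  rw [← hasSum_nat_add_iff' 1]
  simp only [Finset.sum_range_one, Nat.cast_zero, zero_mul, mul_zero, sub_zero]
  refine hasSum_of_forall_eq (h.mul_left t) fun m => ?_
  rw [poissonWeight, poissonWeight, Nat.factorial_succ]
  push_cast
  field_simp
  ring

lemma hasSum_poissonWeight_mul_cast (t : ℝ) :
    HasSum (fun m : ℕ => poissonWeight t m * m) t := by
  have h := hasSum_poissonWeight_mul_cast_mul (f := fun _ => 1) (t := t) (s := 1)
    (by simpa only [mul_one] using hasSum_poissonWeight t)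
  simpa only [mul_one] using h

lemma hasSum_poissonWeight_mul_sub_sq (t : ℝ) :
    HasSum (fun m : ℕ => poissonWeight t m * (m - t) ^ 2) t := by
  have h : HasSum (fun m : ℕ => poissonWeight t m * (m * m)) (t * (t + 1)) := by
    refine hasSum_poissonWeight_mul_cast_mul (f := fun m => (m : ℝ)) ?_
    refine hasSum_of_forall_eq
      ((hasSum_poissonWeight_mul_cast t).add (hasSum_poissonWeight t)) fun m => ?_
    push_cast
    ring
  have h2 := (h.sub ((hasSum_poissonWeight_mul_cast t).mul_left (2 * t))).add
    ((hasSum_poissonWeight t).mul_left (t ^ 2))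
  rw [show t * (t + 1) - 2 * t * t + t ^ 2 * 1 = t by ring] at h2
  refine hasSum_of_forall_eq h2 fun m => ?_
  ring

/-! ### Gaussian approximation of Bernoulli characteristic functions. -/

/-- Factors are exchanged one at a time; the others have norm at most `1` and do not amplify the
error. -/
lemma norm_prod_sub_prod_le {ι : Type*} (S : Finset ι) (f g : ι → ℂ)
    (hf : ∀ i ∈ S, ‖f i‖ ≤ 1) (hg : ∀ i ∈ S, ‖g i‖ ≤ 1) :
    ‖∏ i ∈ S, f i - ∏ i ∈ S, g i‖ ≤ ∑ i ∈ S, ‖f i - g i‖ := by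
  classical
  induction S using Finset.induction_on with
  | empty => simp
  | insert a S ha ih =>
    rw [Finset.prod_insert ha, Finset.prod_insert ha, Finset.sum_insert ha]
    have hgS : ‖∏ i ∈ S, g i‖ ≤ 1 := by
      rw [norm_prod]
      exact Finset.prod_le_one (fun _ _ => norm_nonneg _)
        fun i hi => hg i (Finset.mem_insert_of_mem hi)
    have hS := ih (fun i hi => hf i (Finset.mem_insert_of_mem hi))
      (fun i hi => hg i (Finset.mem_insert_of_mem hi))
    have hfa := hf a (Finset.mem_insert_self a S)
    calc ‖f a * ∏ i ∈ S, f i - g a * ∏ i ∈ S, g i‖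
        = ‖(f a - g a) * ∏ i ∈ S, g i + f a * (∏ i ∈ S, f i - ∏ i ∈ S, g i)‖ := by
          congr 1
          ring
      _ ≤ ‖f a - g a‖ * ‖∏ i ∈ S, g i‖ + ‖f a‖ * ‖∏ i ∈ S, f i - ∏ i ∈ S, g i‖ := by
          rw [← norm_mul, ← norm_mul]
          exact norm_add_le _ _
      _ ≤ ‖f a - g a‖ * 1 + 1 * ∑ i ∈ S, ‖f i - g i‖ := by gcongr
      _ = _ := by ring

lemma norm_exp_mul_I_sub_taylor_le {x : ℝ} (hx : |x| ≤ 1) :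
    ‖Complex.exp (x * Complex.I) - (1 + x * Complex.I - x ^ 2 / 2)‖ ≤ |x| ^ 3 := by
  have hn : ‖(x * Complex.I : ℂ)‖ = |x| := by simp
  have h := Complex.exp_bound (x := x * Complex.I) (by rw [hn]; exact hx) (n := 3) (by norm_num)
  rw [hn] at h
  have hs : ∑ m ∈ Finset.range 3, (x * Complex.I : ℂ) ^ m / m.factorial
      = 1 + x * Complex.I - x ^ 2 / 2 := by
    simp only [Finset.sum_range_succ, Finset.sum_range_zero, mul_pow, Complex.I_sq]
    simp [Nat.factorial]
    ring
  rw [hs] at h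
  refine h.trans ?_
  have : (0 : ℝ) ≤ |x| ^ 3 := by positivity
  norm_num [Nat.factorial]
  linarith

/-- The characteristic function of a centred Bernoulli variable with success probability `b`. -/
noncomputable def bernoulliCharFun (b u : ℝ) : ℂ :=
  (1 - b) * Complex.exp (((-(u * b) : ℝ) : ℂ) * Complex.I)
    + b * Complex.exp (((u * (1 - b) : ℝ) : ℂ) * Complex.I)

lemma norm_bernoulliCharFun_le {b : ℝ} (u : ℝ) (h0 : 0 ≤ b) (h1 : b ≤ 1) :
    ‖bernoulliCharFun b u‖ ≤ 1 := by
  refine (norm_add_le _ _).trans ?_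
  rw [norm_mul, norm_mul, Complex.norm_exp_ofReal_mul_I, Complex.norm_exp_ofReal_mul_I,
    ← Complex.ofReal_one, ← Complex.ofReal_sub, Complex.norm_real, Complex.norm_real,
    Real.norm_of_nonneg h0, Real.norm_of_nonneg (by linarith)]
  linarith

/-- Centring cancels the linear Taylor terms, and the quadratic ones add up to `-u² b (1 - b) / 2`.
Each side has remainder at most `|u|³ b (1 - b)`; keeping the variance as a factor lets the errors
sum to a multiple of the total variance. -/
lemma norm_bernoulliCharFun_sub_le {b u : ℝ} (h0 : 0 ≤ b) (h1 : b ≤ 1) (hu : |u| ≤ 1) :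
    ‖bernoulliCharFun b u - Complex.exp ((-(u ^ 2 * (b * (1 - b)) / 2) : ℝ) : ℂ)‖
      ≤ 2 * |u| ^ 3 * (b * (1 - b)) := by
  have hc : 0 ≤ 1 - b := by linarith
  have hu0 := abs_nonneg u
  have a1 : |-(u * b)| = |u| * b := by rw [abs_neg, abs_mul, abs_of_nonneg h0]
  have a2 : |u * (1 - b)| = |u| * (1 - b) := by rw [abs_mul, abs_of_nonneg hc]
  have e1 := norm_exp_mul_I_sub_taylor_le (x := -(u * b)) (by rw [a1]; nlinarith)
  have e2 := norm_exp_mul_I_sub_taylor_le (x := u * (1 - b)) (by rw [a2]; nlinarith)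
  rw [a1] at e1
  rw [a2] at e2
  set v := b * (1 - b) with hv
  have hv0 : 0 ≤ v := mul_nonneg h0 hc
  have hv1 : v ≤ 1 := by nlinarith
  have hu2 : u ^ 2 ≤ 1 := by rw [← sq_abs]; nlinarith
  have e3 := Real.norm_exp_sub_one_sub_id_le (x := -(u ^ 2 * v / 2)) (by
    rw [Real.norm_eq_abs, abs_neg, abs_of_nonneg (by positivity)]
    nlinarith)
  have e3' : ‖Complex.exp ((-(u ^ 2 * v / 2) : ℝ) : ℂ) - (1 - u ^ 2 * v / 2)‖
      ≤ |u| ^ 3 * v := by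
    have : Complex.exp ((-(u ^ 2 * v / 2) : ℝ) : ℂ) - (1 - u ^ 2 * v / 2)
        = ((Real.exp (-(u ^ 2 * v / 2)) - 1 - -(u ^ 2 * v / 2) : ℝ) : ℂ) := by
      push_cast
      ring
    rw [this, Complex.norm_real]
    refine e3.trans ?_
    rw [Real.norm_eq_abs, sq_abs, ← sq_abs u]
    have h3 : |u| ^ 4 ≤ |u| ^ 3 := pow_le_pow_of_le_one hu0 hu (by norm_num)
    have h4 : v ^ 2 ≤ v := by nlinarith
    calc (-(|u| ^ 2 * v / 2)) ^ 2 = |u| ^ 4 * v ^ 2 / 4 := by ring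
      _ ≤ |u| ^ 4 * v ^ 2 := by linarith [show 0 ≤ |u| ^ 4 * v ^ 2 by positivity]
      _ ≤ |u| ^ 3 * v := by gcongr
  set E1 := Complex.exp (((-(u * b) : ℝ) : ℂ) * Complex.I)
  set E2 := Complex.exp (((u * (1 - b) : ℝ) : ℂ) * Complex.I)
  set E3 := Complex.exp ((-(u ^ 2 * v / 2) : ℝ) : ℂ)
  have key : bernoulliCharFun b u - E3
      = ((1 - b : ℝ) : ℂ) * (E1 - (1 + ((-(u * b) : ℝ) : ℂ) * Complex.I
            - ((-(u * b) : ℝ) : ℂ) ^ 2 / 2))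
        + (b : ℂ) * (E2 - (1 + ((u * (1 - b) : ℝ) : ℂ) * Complex.I
            - ((u * (1 - b) : ℝ) : ℂ) ^ 2 / 2))
        - (E3 - (1 - u ^ 2 * v / 2)) := by
    have hb : bernoulliCharFun b u = (1 - b) * E1 + b * E2 := rfl
    rw [hb, hv]
    push_cast
    ring
  rw [key]
  refine (norm_sub_le _ _).trans ?_
  refine (add_le_add (norm_add_le _ _) le_rfl).trans ?_
  rw [norm_mul, norm_mul, Complex.norm_real, Complex.norm_real, Real.norm_of_nonneg h0,
    Real.norm_of_nonneg hc]
  have f1 : (1 - b) * (|u| * b) ^ 3 + b * (|u| * (1 - b)) ^ 3 ≤ |u| ^ 3 * v := by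
    have : (1 - b) * (|u| * b) ^ 3 + b * (|u| * (1 - b)) ^ 3
        = |u| ^ 3 * v * (b ^ 2 + (1 - b) ^ 2) := by
      rw [hv]
      ring
    rw [this]
    exact mul_le_of_le_one_right (by positivity) (by nlinarith)
  have f2 := mul_le_mul_of_nonneg_left e1 hc
  have f3 := mul_le_mul_of_nonneg_left e2 h0
  linarith

/-! ### Counts restricted to a finite set, and avoidance events. -/

/-- The number of elements of `S` among the first `n` terms of the sequence `ξ`. -/
def partialR {Ω : Type*} (ξ : ℕ → Ω → ℕ+) (S : Finset ℕ+) (n : ℕ) (ω : Ω) : ℕ :=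
  (S ∩ (Finset.range n).image (fun k => ξ k ω)).card

/-- The event that none of the first `n` terms of the sequence `ξ` lies in `A`. -/
def avoid {Ω : Type*} (ξ : ℕ → Ω → ℕ+) (A : Finset ℕ+) (n : ℕ) : Set Ω :=
  ⋂ k ∈ Finset.range n, ξ k ⁻¹' (A : Set ℕ+)ᶜ

lemma mem_avoid {Ω : Type*} {ξ : ℕ → Ω → ℕ+} {A : Finset ℕ+} {n : ℕ} {ω : Ω} :
    ω ∈ avoid ξ A n ↔ ∀ i ∈ A, i ∉ (Finset.range n).image (fun k => ξ k ω) := by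
  simp only [avoid, Set.mem_iInter, Set.mem_preimage, Set.mem_compl_iff, Finset.mem_coe,
    Finset.mem_image, Finset.mem_range, not_exists, not_and]
  exact ⟨fun h i hi k hk e => h k hk (e ▸ hi), fun h k hk hi => h _ hi k hk rfl⟩

lemma partialR_mono {Ω : Type*} (ξ : ℕ → Ω → ℕ+) (S : Finset ℕ+) {m n : ℕ} (h : m ≤ n) (ω : Ω) :
    partialR ξ S m ω ≤ partialR ξ S n ω := by
  unfold partialR
  gcongr

lemma eventually_partialR_eq_R {Ω : Type*} (ξ : ℕ → Ω → ℕ+) (n : ℕ) (ω : Ω) :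
    ∀ᶠ S in atTop, partialR ξ S n ω = R ξ n ω := by
  filter_upwards [eventually_ge_atTop ((Finset.range n).image (fun k => ξ k ω))] with S hS
  rw [partialR, R, Finset.inter_eq_right.2 hS]

/-- The power is a product over `i ∈ S` of `(1 - z) 1[i unseen] + z`, expanded over subsets. Only
avoidance events remain, and their probabilities are explicit. -/
lemma pow_partialR_eq_sum {Ω : Type*} (ξ : ℕ → Ω → ℕ+) (S : Finset ℕ+) (n : ℕ) (ω : Ω) (z : ℂ) :
    z ^ partialR ξ S n ω = ∑ A ∈ S.powerset,
      (1 - z) ^ A.card * z ^ (S \ A).card * (avoid ξ A n).indicator (fun _ => 1) ω := by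
  classical
  set V := (Finset.range n).image (fun k => ξ k ω) with hV
  have h1 : z ^ partialR ξ S n ω = ∏ i ∈ S, ((1 - z) * (if i ∈ V then 0 else 1) + z) := by
    rw [partialR, ← hV, ← Finset.filter_mem_eq_inter, ← Finset.prod_const, Finset.prod_filter]
    refine Finset.prod_congr rfl fun i _ => ?_
    split_ifs <;> ring
  rw [h1, Finset.prod_add]
  refine Finset.sum_congr rfl fun A _ => ?_
  rw [Finset.prod_mul_distrib, Finset.prod_const, Finset.prod_const, mul_assoc, mul_assoc,
    mul_comm (z ^ _)]
  congr 2
  by_cases h : ω ∈ avoid ξ A n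
  · rw [Set.indicator_of_mem h]
    exact Finset.prod_eq_one fun i hi => if_neg (mem_avoid.1 h i hi)
  · rw [Set.indicator_of_notMem h]
    rw [mem_avoid] at h
    push Not at h
    obtain ⟨i, hi, hiV⟩ := h
    exact Finset.prod_eq_zero hi (if_pos hiV)

lemma partialR_eq_sum {Ω : Type*} (ξ : ℕ → Ω → ℕ+) (S : Finset ℕ+) (n : ℕ) (ω : Ω) :
    (partialR ξ S n ω : ℝ) = ∑ i ∈ S, (1 - (avoid ξ {i} n).indicator (fun _ => (1 : ℝ)) ω) := by
  rw [partialR, ← Finset.filter_mem_eq_inter, Finset.card_filter, Nat.cast_sum]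
  refine Finset.sum_congr rfl fun i _ => ?_
  by_cases h : i ∈ (Finset.range n).image (fun k => ξ k ω)
  · rw [if_pos h, Set.indicator_of_notMem (by simpa [mem_avoid] using h)]
    simp
  · rw [if_neg h, Set.indicator_of_mem (by simpa [mem_avoid] using h)]
    simp

/-! ### Poissonization and de-Poissonization for finite sets of values. -/

section

variable {Ω : Type*} [MeasurableSpace Ω] {P : Measure Ω}
  {π : Measure ℕ+} [IsProbabilityMeasure π] {ξ : ℕ → Ω → ℕ+}

/-- The count factors through the tuple of the first `n` draws, which lives in a discrete space. -/
lemma aemeasurable_R (hξ : ∀ k, AEMeasurable (ξ k) P) (n : ℕ) :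
    AEMeasurable (fun ω => (R ξ n ω : ℝ)) P := by
  have h : AEMeasurable (fun ω => fun k : Fin n => ξ k ω) P :=
    aemeasurable_pi_lambda _ fun k => hξ k
  have e : (fun ω => (R ξ n ω : ℝ))
      = (fun x : Fin n → ℕ+ => (((Finset.univ.image x).card : ℕ) : ℝ))
        ∘ fun ω => fun k : Fin n => ξ k ω := by
    funext ω
    simp only [R, Function.comp]
    congr 2
    ext i
    simp only [Finset.mem_image, Finset.mem_range, Finset.mem_univ, true_and]
    exact ⟨fun ⟨k, hk, h⟩ => ⟨⟨k, hk⟩, h⟩, fun ⟨k, h⟩ => ⟨k, k.2, h⟩⟩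
  rw [e]
  exact Measurable.comp_aemeasurable .of_discrete h

lemma nullMeasurableSet_avoid (hξ : ∀ k, AEMeasurable (ξ k) P) (A : Finset ℕ+) (n : ℕ) :
    NullMeasurableSet (avoid ξ A n) P :=
  Finset.nullMeasurableSet_biInter _ fun k _ =>
    (hξ k).nullMeasurableSet_preimage (.of_discrete)

lemma measureReal_avoid (hlaw : ∀ k, HasLaw (ξ k) π P) (hindep : iIndepFun ξ P)
    (A : Finset ℕ+) (n : ℕ) : P.real (avoid ξ A n) = (1 - π.real (A : Set ℕ+)) ^ n := by
  rw [Measure.real, avoid, iIndepFun_iff_measure_inter_preimage_eq_mul.1 hindep _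
    (fun _ _ => .of_discrete), ENNReal.toReal_prod]
  rw [Finset.prod_congr rfl (g := fun _ => 1 - π.real (A : Set ℕ+)) ?_, Finset.prod_const,
    Finset.card_range]
  intro k _
  rw [← Measure.map_apply_of_aemeasurable (hlaw k).aemeasurable .of_discrete, (hlaw k).map_eq]
  exact probReal_compl_eq_one_sub .of_discrete

variable [IsProbabilityMeasure P]

lemma integrable_indicator_avoid (hξ : ∀ k, AEMeasurable (ξ k) P) {E : Type*}
    [NormedAddCommGroup E] (A : Finset ℕ+) (n : ℕ) (c : E) :
    Integrable ((avoid ξ A n).indicator fun _ => c) P :=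
  (integrable_const c).indicator₀ (nullMeasurableSet_avoid hξ A n)

lemma integrable_pow_partialR (hξ : ∀ k, AEMeasurable (ξ k) P) (S : Finset ℕ+) (n : ℕ) (z : ℂ) :
    Integrable (fun ω => z ^ partialR ξ S n ω) P := by
  simp_rw [pow_partialR_eq_sum]
  exact integrable_finsetSum _ fun A _ => (integrable_indicator_avoid hξ A n 1).const_mul _

lemma integral_pow_partialR (hlaw : ∀ k, HasLaw (ξ k) π P) (hindep : iIndepFun ξ P)
    (S : Finset ℕ+) (n : ℕ) (z : ℂ) :
    ∫ ω, z ^ partialR ξ S n ω ∂P = ∑ A ∈ S.powerset,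
      (1 - z) ^ A.card * z ^ (S \ A).card * ((1 - π.real (A : Set ℕ+)) ^ n : ℝ) := by
  have hξ := fun k => (hlaw k).aemeasurable
  simp_rw [pow_partialR_eq_sum]
  rw [integral_finsetSum _ fun A _ => (integrable_indicator_avoid hξ A n 1).const_mul _]
  refine Finset.sum_congr rfl fun A _ => ?_
  rw [integral_const_mul, integral_indicator₀ (nullMeasurableSet_avoid hξ A n),
    setIntegral_const, measureReal_avoid hlaw hindep]
  simp

/-- After a Poisson number of draws with mean `t`, the events that distinct values occur are
independent: the generating function of `partialR` factors. -/
lemma hasSum_poissonWeight_mul_integral_pow_partialR (hlaw : ∀ k, HasLaw (ξ k) π P)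
    (hindep : iIndepFun ξ P) (S : Finset ℕ+) (t : ℝ) (z : ℂ) :
    HasSum (fun m => (poissonWeight t m : ℂ) * ∫ ω, z ^ partialR ξ S m ω ∂P)
      (∏ i ∈ S, ((1 - z) * Real.exp (-t * π.real {i}) + z)) := by
  classical
  rw [Finset.prod_add]
  simp_rw [integral_pow_partialR hlaw hindep, Finset.mul_sum]
  refine hasSum_sum fun A _ => ?_
  have h := (Complex.hasSum_ofReal.2
    (hasSum_poissonWeight_mul_pow t (1 - π.real (A : Set ℕ+)))).mul_left
      ((1 - z) ^ A.card * z ^ (S \ A).card)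
  -- Independence appears here: Poisson averaging turns `(1 - π(A))^m` into `exp (-t π(A))`, which
  -- is multiplicative over the points of `A`.
  have e : Real.exp (t * (1 - π.real (A : Set ℕ+) - 1)) = ∏ i ∈ A, Real.exp (-t * π.real {i}) := by
    rw [← Real.exp_sum, ← Finset.mul_sum, sum_measureReal_singleton]
    congr 1
    ring
  rw [e, mul_right_comm, Complex.ofReal_prod, ← Finset.prod_const, ← Finset.prod_mul_distrib,
    ← Finset.prod_const] at h
  refine hasSum_of_forall_eq h fun m => ?_
  rw [Finset.prod_const, Finset.prod_const]
  push_cast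
  ring

lemma integrable_partialR (hξ : ∀ k, AEMeasurable (ξ k) P) (S : Finset ℕ+) (n : ℕ) :
    Integrable (fun ω => (partialR ξ S n ω : ℝ)) P := by
  simp_rw [partialR_eq_sum]
  exact integrable_finsetSum _ fun i _ =>
    (integrable_const 1).sub (integrable_indicator_avoid hξ {i} n 1)

lemma integral_partialR (hlaw : ∀ k, HasLaw (ξ k) π P) (hindep : iIndepFun ξ P)
    (S : Finset ℕ+) (n : ℕ) :
    ∫ ω, (partialR ξ S n ω : ℝ) ∂P = ∑ i ∈ S, (1 - (1 - π.real {i}) ^ n) := by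
  have hξ := fun k => (hlaw k).aemeasurable
  simp_rw [partialR_eq_sum]
  have hi : ∀ i ∈ S, Integrable
      (fun ω => 1 - (avoid ξ {i} n).indicator (fun _ => (1 : ℝ)) ω) P := fun i _ =>
    (integrable_const 1).sub (integrable_indicator_avoid hξ {i} n 1)
  rw [integral_finsetSum _ hi]
  refine Finset.sum_congr rfl fun i _ => ?_
  rw [integral_sub (integrable_const 1) (integrable_indicator_avoid hξ {i} n 1),
    integral_indicator₀ (nullMeasurableSet_avoid hξ {i} n), setIntegral_const,
    measureReal_avoid hlaw hindep]
  simp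

lemma norm_exp_mul_I_pow_sub_pow_le (u : ℝ) (a b : ℕ) :
    ‖Complex.exp (u * Complex.I) ^ a - Complex.exp (u * Complex.I) ^ b‖ ≤ |u| * |(a : ℝ) - b| := by
  rw [← Complex.exp_nat_mul, ← Complex.exp_nat_mul]
  have e : (a : ℂ) * (u * Complex.I)
      = b * (u * Complex.I) + Complex.I * ((u * ((a : ℝ) - b) : ℝ) : ℂ) := by
    push_cast
    ring
  have hb : ‖Complex.exp ((b : ℂ) * (u * Complex.I))‖ = 1 := by
    rw [← mul_assoc, ← Complex.ofReal_natCast, ← Complex.ofReal_mul,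
      Complex.norm_exp_ofReal_mul_I]
  rw [e, Complex.exp_add, ← mul_sub_one, norm_mul, hb, one_mul, ← abs_mul]
  exact Real.norm_exp_I_mul_ofReal_sub_one_le

/-- Both counts use the same sequence and are monotone in the number of draws, so the mean absolute
difference is a difference of means. -/
lemma norm_integral_pow_partialR_sub_le_of_le (hlaw : ∀ k, HasLaw (ξ k) π P)
    (hindep : iIndepFun ξ P) (S : Finset ℕ+) {m n : ℕ} (hmn : m ≤ n) (u : ℝ) :
    ‖∫ ω, Complex.exp (u * Complex.I) ^ partialR ξ S m ω ∂P
        - ∫ ω, Complex.exp (u * Complex.I) ^ partialR ξ S n ω ∂P‖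
      ≤ |u| * ∑ i ∈ S, ((1 - π.real {i}) ^ m - (1 - π.real {i}) ^ n) := by
  have hξ := fun k => (hlaw k).aemeasurable
  rw [← integral_sub (integrable_pow_partialR hξ S m _) (integrable_pow_partialR hξ S n _)]
  have hi := ((integrable_partialR hξ S n).sub (integrable_partialR hξ S m)).const_mul |u|
  refine (norm_integral_le_of_norm_le hi (.of_forall fun ω => ?_)).trans_eq ?_
  · refine (norm_exp_mul_I_pow_sub_pow_le u _ _).trans_eq ?_
    have : (partialR ξ S m ω : ℝ) ≤ partialR ξ S n ω := mod_cast partialR_mono ξ S hmn ω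
    rw [abs_sub_comm, abs_of_nonneg (sub_nonneg.2 this)]
    rfl
  · rw [integral_const_mul]
    simp only [Pi.sub_apply]
    rw [integral_sub (integrable_partialR hξ S n) (integrable_partialR hξ S m),
      integral_partialR hlaw hindep, integral_partialR hlaw hindep, ← Finset.sum_sub_distrib]
    congr 2
    ext i
    ring

lemma norm_integral_pow_partialR_le (S : Finset ℕ+) (m : ℕ) (u : ℝ) :
    ‖∫ ω, Complex.exp (u * Complex.I) ^ partialR ξ S m ω ∂P‖ ≤ 1 := by
  refine (norm_integral_le_of_norm_le (integrable_const (1 : ℝ)) (.of_forall fun ω => ?_)).trans_eq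
    (by simp)
  rw [norm_pow, Complex.norm_exp_ofReal_mul_I, one_pow]

lemma one_sub_pow_sub_one_sub_pow_le {p : ℝ} (h0 : 0 ≤ p) (h1 : p ≤ 1) {m n : ℕ} (hmn : m ≤ n) :
    (1 - p) ^ m - (1 - p) ^ n ≤ ((n : ℝ) - m) * (p * Real.exp (-(m * p))) := by
  obtain ⟨k, rfl⟩ := Nat.exists_eq_add_of_le hmn
  have e1 : (1 - p) ^ m ≤ Real.exp (-(m * p)) := by
    rw [← mul_neg, Real.exp_nat_mul]
    exact pow_le_pow_left₀ (by linarith) (Real.one_sub_le_exp_neg p) m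
  have e2 : 1 - (1 - p) ^ k ≤ k * p := by
    have := one_add_mul_le_pow (a := -p) (by linarith) k
    rw [← sub_eq_add_neg] at this
    linarith
  have e3 : (1 - p) ^ k ≤ 1 := pow_le_one₀ (by linarith) (by linarith)
  rw [pow_add, show (1 - p) ^ m - (1 - p) ^ m * (1 - p) ^ k
    = (1 - (1 - p) ^ k) * (1 - p) ^ m by ring]
  push_cast
  calc (1 - (1 - p) ^ k) * (1 - p) ^ m ≤ (k * p) * Real.exp (-(m * p)) := by
        gcongr
    _ = _ := by ring

lemma norm_integral_pow_partialR_sub_le (hlaw : ∀ k, HasLaw (ξ k) π P)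
    (hindep : iIndepFun ξ P) (S : Finset ℕ+) (m : ℕ) {n : ℕ} (hn : 0 < n) (u : ℝ) :
    ‖∫ ω, Complex.exp (u * Complex.I) ^ partialR ξ S m ω ∂P
        - ∫ ω, Complex.exp (u * Complex.I) ^ partialR ξ S n ω ∂P‖
      ≤ |u| * |(m : ℝ) - n| * ∑ i ∈ S, π.real {i} * Real.exp (-(3 / 4 * n * π.real {i}))
        + 32 / n ^ 2 * ((m : ℝ) - n) ^ 2 := by
  have hn0 : (0 : ℝ) < n := by exact_mod_cast hn
  -- Any fraction strictly between `1/2` and `1` would serve as threshold: above `1/2`, the squared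
  -- exponential in `sqrt_mul_sum_le` still has decay to spare.
  have key : ∀ a b : ℕ, a ≤ b → 3 / 4 * (n : ℝ) ≤ a →
      ‖∫ ω, Complex.exp (u * Complex.I) ^ partialR ξ S a ω ∂P
        - ∫ ω, Complex.exp (u * Complex.I) ^ partialR ξ S b ω ∂P‖
      ≤ |u| * ((b : ℝ) - a) * ∑ i ∈ S, π.real {i} * Real.exp (-(3 / 4 * n * π.real {i})) := by
    intro a b hab ha
    refine (norm_integral_pow_partialR_sub_le_of_le hlaw hindep S hab u).trans ?_
    rw [mul_assoc]
    refine mul_le_mul_of_nonneg_left ?_ (abs_nonneg u)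
    rw [Finset.mul_sum]
    refine Finset.sum_le_sum fun i _ => ?_
    refine (one_sub_pow_sub_one_sub_pow_le measureReal_nonneg measureReal_le_one hab).trans ?_
    have : (0 : ℝ) ≤ (b : ℝ) - a := sub_nonneg.2 (mod_cast hab)
    gcongr
  have hs : 0 ≤ ∑ i ∈ S, π.real {i} * Real.exp (-(3 / 4 * n * π.real {i})) :=
    Finset.sum_nonneg fun i _ => by positivity
  have h32 : 0 ≤ 32 / (n : ℝ) ^ 2 * ((m : ℝ) - n) ^ 2 := by positivity
  by_cases hm : 3 / 4 * (n : ℝ) ≤ m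
  · rcases le_total m n with h | h
    · have := key m n h hm
      rw [abs_sub_comm (m : ℝ), abs_of_nonneg (sub_nonneg.2 (mod_cast h : (m : ℝ) ≤ n))]
      linarith
    · have := key n m h (by linarith)
      rw [norm_sub_rev, abs_of_nonneg (sub_nonneg.2 (mod_cast h : (n : ℝ) ≤ m))]
      linarith
  · push Not at hm
    -- Here `(m - n)² > n² / 16`, so the constant `32` makes this term dominate the trivial bound
    -- `2`.
    have h2 : (2 : ℝ) ≤ 32 / n ^ 2 * ((m : ℝ) - n) ^ 2 := by
      rw [div_mul_eq_mul_div, le_div_iff₀ (by positivity)]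
      nlinarith
    have h3 := norm_sub_le_of_le (norm_integral_pow_partialR_le (P := P) (ξ := ξ) S m u)
      (norm_integral_pow_partialR_le (P := P) (ξ := ξ) S n u)
    have h4 : 0 ≤ |u| * |(m : ℝ) - n| * ∑ i ∈ S, π.real {i} * Real.exp (-(3 / 4 * n * π.real {i})) :=
      by positivity
    linarith

/-- De-Poissonization of the characteristic function of `partialR ξ S n`. -/
lemma norm_integral_pow_partialR_sub_prod_le (hlaw : ∀ k, HasLaw (ξ k) π P)
    (hindep : iIndepFun ξ P) (S : Finset ℕ+) {n : ℕ} (hn : 0 < n) (u : ℝ) :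
    ‖∫ ω, Complex.exp (u * Complex.I) ^ partialR ξ S n ω ∂P
        - ∏ i ∈ S, ((1 - Complex.exp (u * Complex.I)) * Real.exp (-n * π.real {i})
          + Complex.exp (u * Complex.I))‖
      ≤ |u| * √n * ∑ i ∈ S, π.real {i} * Real.exp (-(3 / 4 * n * π.real {i})) + 32 / n := by
  have hn0 : (0 : ℝ) < n := by exact_mod_cast hn
  have hsq : (0 : ℝ) < √n := Real.sqrt_pos.2 hn0
  set T := ∑ i ∈ S, π.real {i} * Real.exp (-(3 / 4 * n * π.real {i}))
  have hT : 0 ≤ T := Finset.sum_nonneg fun i _ => by positivity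
  have h1 := hasSum_poissonWeight_mul_integral_pow_partialR hlaw hindep S n
    (Complex.exp (u * Complex.I))
  have h2 := (Complex.hasSum_ofReal.2 (hasSum_poissonWeight n)).mul_right
    (∫ ω, Complex.exp (u * Complex.I) ^ partialR ξ S n ω ∂P)
  have h3 := h1.sub h2
  have h4 := ((hasSum_poissonWeight n).mul_left (|u| * T * √n / 2)).add
    ((hasSum_poissonWeight_mul_sub_sq n).mul_left (|u| * T / (2 * √n) + 32 / n ^ 2))
  have h5 := h3.norm_le_of_bounded h4 fun m => ?_
  · rw [Complex.ofReal_one, one_mul, norm_sub_rev] at h5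
    refine h5.trans_eq ?_
    have : (n : ℝ) = √n * √n := (Real.mul_self_sqrt hn0.le).symm
    have e : |u| * T / (2 * √n) * n = |u| * T * √n / 2 := by
      nth_rewrite 2 [this]
      field_simp
    rw [add_mul, e]
    field_simp
    ring
  · rw [← mul_sub, norm_mul, Complex.norm_real,
      Real.norm_of_nonneg (poissonWeight_nonneg hn0.le m)]
    have h6 := norm_integral_pow_partialR_sub_le hlaw hindep S m hn u
    -- AM–GM linearizes the absolute deviation, so that total mass and variance of the Poisson law
    -- suffice.
    have h7 : |(m : ℝ) - n| ≤ √n / 2 + ((m : ℝ) - n) ^ 2 / (2 * √n) := by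
      rw [← sq_abs]
      have : √n / 2 + |(m : ℝ) - n| ^ 2 / (2 * √n) - |(m : ℝ) - n|
          = (√n - |(m : ℝ) - n|) ^ 2 / (2 * √n) := by
        field_simp
        ring
      have h8 : 0 ≤ (√n - |(m : ℝ) - n|) ^ 2 / (2 * √n) := by positivity
      linarith
    have h9 : |u| * |(m : ℝ) - n| * T
        ≤ |u| * (√n / 2 + ((m : ℝ) - n) ^ 2 / (2 * √n)) * T := by gcongr
    calc _ ≤ poissonWeight n m * (|u| * (√n / 2 + ((m : ℝ) - n) ^ 2 / (2 * √n)) * T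
            + 32 / n ^ 2 * ((m : ℝ) - n) ^ 2) :=
          mul_le_mul_of_nonneg_left (h6.trans (by linarith)) (poissonWeight_nonneg hn0.le m)
      _ = _ := by
          field_simp
          ring

end

/-! ### Comparison of the de-Poissonization error with the variance. -/

section

open Topology

variable {π : Measure ℕ+} [IsProbabilityMeasure π]

/-- The sum `∑ π_i h(t π_i)` with `h(x) = (1 + x) exp (-x / 2)`, which controls the variance
lost when a Poisson number of draws is replaced by a fixed one. -/
noncomputable def depoissonError (π : Measure ℕ+) (t : ℝ) : ℝ :=
  ∑' i : ℕ+, π.real {i} * ((1 + t * π.real {i}) * Real.exp (-(t * π.real {i} / 2)))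

lemma summable_measureReal_singleton (π : Measure ℕ+) [IsProbabilityMeasure π] :
    Summable fun i : ℕ+ => π.real {i} := by
  refine summable_of_sum_le (c := 1) (fun _ => measureReal_nonneg) fun S => ?_
  rw [sum_measureReal_singleton]
  exact measureReal_le_one

lemma one_add_mul_exp_neg_half_le {x : ℝ} : (1 + x) * Real.exp (-(x / 2)) ≤ 2 := by
  have h := Real.add_one_le_exp (x / 2)
  rw [Real.exp_neg, ← div_eq_mul_inv, div_le_iff₀ (Real.exp_pos _)]
  linarith

lemma summable_depoissonError (π : Measure ℕ+) [IsProbabilityMeasure π] {t : ℝ} (ht : 0 ≤ t) :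
    Summable fun i : ℕ+ =>
      π.real {i} * ((1 + t * π.real {i}) * Real.exp (-(t * π.real {i} / 2))) :=
  Summable.of_nonneg_of_le (fun i => by positivity)
    (fun i => mul_le_mul_of_nonneg_left one_add_mul_exp_neg_half_le measureReal_nonneg)
    ((summable_measureReal_singleton π).mul_right 2)

lemma tendsto_one_add_mul_exp_neg_half :
    Tendsto (fun x : ℝ => (1 + x) * Real.exp (-(x / 2))) atTop (𝓝 0) := by
  have h0 : Tendsto (fun y : ℝ => Real.exp (-y) + 2 * (y ^ 1 * Real.exp (-y))) atTop (𝓝 0) := by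
    simpa using Real.tendsto_exp_neg_atTop_nhds_zero.add
      ((Real.tendsto_pow_mul_exp_neg_atTop_nhds_zero 1).const_mul 2)
  refine (h0.comp (tendsto_id.atTop_div_const (two_pos (α := ℝ)))).congr fun x => ?_
  simp only [Function.comp, id]
  ring

/-- Dominated convergence: `(1 + x) exp (-x / 2)` is at most `2` and vanishes at infinity, and the
masses are summable. -/
lemma tendsto_depoissonError (π : Measure ℕ+) [IsProbabilityMeasure π] :
    Tendsto (fun n : ℕ => depoissonError π n) atTop (𝓝 0) := by
  have h := tendsto_tsum_of_dominated_convergence (𝓕 := atTop)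
    (f := fun (n : ℕ) (i : ℕ+) =>
      π.real {i} * ((1 + n * π.real {i}) * Real.exp (-(n * π.real {i} / 2))))
    (g := fun _ => (0 : ℝ)) ((summable_measureReal_singleton π).mul_right 2) (fun i => ?_)
    (.of_forall fun n i => ?_)
  · simpa [depoissonError] using h
  · rcases (measureReal_nonneg (μ := π) (s := {i})).eq_or_lt with h0 | h0
    · simp [← h0]
    · simpa using (tendsto_one_add_mul_exp_neg_half.comp
        (tendsto_natCast_atTop_atTop.atTop_mul_const h0)).const_mul (π.real {i})
  · rw [Real.norm_of_nonneg (by positivity)]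
    exact mul_le_mul_of_nonneg_left one_add_mul_exp_neg_half_le measureReal_nonneg

/-- The variance of the indicator that a value of mass `p` occurs in a Poisson number of draws
with mean `t`. -/
noncomputable def occurrenceVar (t p : ℝ) : ℝ :=
  (1 - Real.exp (-t * p)) * (1 - (1 - Real.exp (-t * p)))

lemma occurrenceVar_nonneg {t p : ℝ} (ht : 0 ≤ t) (hp : 0 ≤ p) : 0 ≤ occurrenceVar t p := by
  have : Real.exp (-t * p) ≤ 1 := Real.exp_le_one_iff.2 (by nlinarith)
  have := Real.exp_pos (-t * p)
  exact mul_nonneg (by linarith) (by linarith)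

lemma hasSum_occurrenceVar (π : Measure ℕ+) [IsProbabilityMeasure π] {t : ℝ} (ht : 0 ≤ t) :
    HasSum (fun i : ℕ+ => occurrenceVar t (π.real {i})) (sigma π t ^ 2) := by
  have h : HasSum (fun i : ℕ+ => occurrenceVar t (π.real {i})) (mu π (2 * t) - mu π t) := by
    refine hasSum_of_forall_eq
      ((summable_mu π (show 0 ≤ 2 * t by linarith)).hasSum.sub (summable_mu π ht).hasSum)
      fun i => ?_
    rw [occurrenceVar, show -(2 * t) * π.real {i} = -t * π.real {i} + -t * π.real {i} by ring,
      Real.exp_add]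
    ring
  rwa [sigma, Real.sq_sqrt (h.nonneg fun i => occurrenceVar_nonneg ht measureReal_nonneg)]

/-- Cauchy–Schwarz, term by term: with `x = t π_i`, the estimate `x ≤ (1 + x) (1 - exp (-x))` splits
`t π_i² exp (-3 x / 2)` into a term of `depoissonError` and the variance `exp (-x) (1 - exp (-x))`.
-/
lemma sqrt_mul_sum_le (π : Measure ℕ+) [IsProbabilityMeasure π] {t : ℝ} (ht : 0 ≤ t)
    (S : Finset ℕ+) :
    √t * ∑ i ∈ S, π.real {i} * Real.exp (-(3 / 4 * t * π.real {i}))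
      ≤ √(depoissonError π t) * √(∑ i ∈ S, occurrenceVar t (π.real {i})) := by
  have h0 : 0 ≤ depoissonError π t := tsum_nonneg fun i => by positivity
  rw [← Real.sqrt_mul h0]
  refine Real.le_sqrt_of_sq_le ?_
  rw [Finset.mul_sum]
  refine (Finset.sum_sq_le_sum_mul_sum_of_sq_le_mul S
    (f := fun i => π.real {i} * ((1 + t * π.real {i}) * Real.exp (-(t * π.real {i} / 2))))
    (g := fun i => occurrenceVar t (π.real {i})) (fun i _ => by positivity)
    (fun i _ => occurrenceVar_nonneg ht measureReal_nonneg) fun i _ => ?_).trans ?_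
  · set p := π.real {i} with hp
    have hp0 : 0 ≤ p := measureReal_nonneg
    have h1 : (1 + t * p) * Real.exp (-t * p) ≤ 1 := by
      have := Real.add_one_le_exp (t * p)
      rw [neg_mul, Real.exp_neg, ← div_eq_mul_inv, div_le_one (Real.exp_pos _)]
      linarith
    have e1 : Real.exp (-(3 / 4 * t * p)) ^ 2 = Real.exp (-(t * p / 2)) * Real.exp (-t * p) := by
      rw [← Real.exp_nat_mul, ← Real.exp_add]
      congr 1
      push_cast
      ring
    have h2 : t * p ≤ (1 + t * p) * (1 - Real.exp (-t * p)) := by linarith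
    rw [mul_pow, mul_pow, Real.sq_sqrt ht, e1, occurrenceVar]
    calc t * (p ^ 2 * (Real.exp (-(t * p / 2)) * Real.exp (-t * p)))
        = (t * p) * (p * (Real.exp (-(t * p / 2)) * Real.exp (-t * p))) := by ring
      _ ≤ ((1 + t * p) * (1 - Real.exp (-t * p)))
          * (p * (Real.exp (-(t * p / 2)) * Real.exp (-t * p))) := by gcongr
      _ = _ := by ring
  · exact mul_le_mul_of_nonneg_right
      ((summable_depoissonError π ht).sum_le_tsum S fun i _ => by positivity)
      (Finset.sum_nonneg fun i _ => occurrenceVar_nonneg ht measureReal_nonneg)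

/-! ### Quantitative Gaussian approximation of the characteristic function. -/

variable {Ω : Type*} [MeasurableSpace Ω] {P : Measure Ω} {ξ : ℕ → Ω → ℕ+}

lemma charFun_normalized_R_eq (hξ : ∀ k, AEMeasurable (ξ k) P) (n : ℕ) (m s θ : ℝ) :
    charFun (P.map fun ω => ((R ξ n ω : ℝ) - m) / s) θ
      = Complex.exp (((-(θ / s * m) : ℝ) : ℂ) * Complex.I)
        * ∫ ω, Complex.exp ((θ / s : ℝ) * Complex.I) ^ R ξ n ω ∂P := by
  rw [charFun_apply_real, integral_map (((aemeasurable_R hξ n).sub_const m).div_const s)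
    (by fun_prop), ← integral_const_mul]
  congr 1
  ext ω
  rw [← Complex.exp_nat_mul, ← Complex.exp_add]
  congr 1
  push_cast
  ring

variable [IsProbabilityMeasure P]

lemma norm_centered_partialR_sub_gaussian_le (hlaw : ∀ k, HasLaw (ξ k) π P)
    (hindep : iIndepFun ξ P) (S : Finset ℕ+) {n : ℕ} (hn : 0 < n) {u : ℝ} (hu : |u| ≤ 1) :
    ‖Complex.exp (((-(u * ∑ i ∈ S, (1 - Real.exp (-n * π.real {i}))) : ℝ) : ℂ) * Complex.I)
        * ∫ ω, Complex.exp (u * Complex.I) ^ partialR ξ S n ω ∂P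
      - Complex.exp ((-(u ^ 2 * (∑ i ∈ S, occurrenceVar n (π.real {i})) / 2) : ℝ) : ℂ)‖
    ≤ |u| * (√(depoissonError π n) * √(∑ i ∈ S, occurrenceVar n (π.real {i}))) + 32 / n
      + 2 * |u| ^ 3 * ∑ i ∈ S, occurrenceVar n (π.real {i}) := by
  have hn0 : (0 : ℝ) ≤ n := n.cast_nonneg
  set b : ℕ+ → ℝ := fun i => 1 - Real.exp (-n * π.real {i}) with hb
  have hb0 : ∀ i, 0 ≤ b i := fun i => by
    have : Real.exp (-n * π.real {i}) ≤ 1 :=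
      Real.exp_le_one_iff.2 (by nlinarith [measureReal_nonneg (μ := π) (s := {i})])
    simp only [hb]
    linarith
  have hb1 : ∀ i, b i ≤ 1 := fun i => by
    have := Real.exp_pos (-n * π.real {i})
    simp only [hb]
    linarith
  set z := Complex.exp (u * Complex.I) with hz
  set c := Complex.exp (((-(u * ∑ i ∈ S, b i) : ℝ) : ℂ) * Complex.I) with hc
  have hc1 : ‖c‖ = 1 := Complex.norm_exp_ofReal_mul_I _
  have hprod : c * ∏ i ∈ S, ((1 - z) * Real.exp (-n * π.real {i}) + z)
      = ∏ i ∈ S, bernoulliCharFun (b i) u := by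
    have : c = ∏ i ∈ S, Complex.exp (((-(u * b i) : ℝ) : ℂ) * Complex.I) := by
      rw [hc, ← Complex.exp_sum, ← Finset.sum_mul, ← Complex.ofReal_sum, Finset.mul_sum,
        Finset.sum_neg_distrib]
    rw [this, ← Finset.prod_mul_distrib]
    refine Finset.prod_congr rfl fun i _ => ?_
    have e1 : Complex.exp (((u * (1 - b i) : ℝ) : ℂ) * Complex.I)
        = z * Complex.exp (((-(u * b i) : ℝ) : ℂ) * Complex.I) := by
      rw [hz, ← Complex.exp_add]
      congr 1
      push_cast
      ring
    have e2 : ((Real.exp (-n * π.real {i}) : ℝ) : ℂ) = 1 - (b i : ℂ) := by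
      simp only [hb]
      push_cast
      ring
    rw [bernoulliCharFun, e1, e2]
    ring
  have hgauss : Complex.exp ((-(u ^ 2 * (∑ i ∈ S, occurrenceVar n (π.real {i})) / 2) : ℝ) : ℂ)
      = ∏ i ∈ S, Complex.exp ((-(u ^ 2 * (b i * (1 - b i)) / 2) : ℝ) : ℂ) := by
    rw [← Complex.exp_sum, ← Complex.ofReal_sum, Finset.sum_neg_distrib, ← Finset.sum_div,
      ← Finset.mul_sum]
    rfl
  have h1 : ‖∏ i ∈ S, bernoulliCharFun (b i) u
      - ∏ i ∈ S, Complex.exp ((-(u ^ 2 * (b i * (1 - b i)) / 2) : ℝ) : ℂ)‖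
      ≤ 2 * |u| ^ 3 * ∑ i ∈ S, occurrenceVar n (π.real {i}) := by
    refine (norm_prod_sub_prod_le S _ _ (fun i _ => norm_bernoulliCharFun_le u (hb0 i) (hb1 i))
      fun i _ => ?_).trans ?_
    · rw [← Complex.ofReal_exp, Complex.norm_real, Real.norm_of_nonneg (Real.exp_pos _).le]
      refine Real.exp_le_one_iff.2 ?_
      have := mul_nonneg (hb0 i) (sub_nonneg.2 (hb1 i))
      have : 0 ≤ u ^ 2 * (b i * (1 - b i)) / 2 := by positivity
      linarith
    · rw [Finset.mul_sum]
      exact Finset.sum_le_sum fun i _ => norm_bernoulliCharFun_sub_le (hb0 i) (hb1 i) hu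
  have h2 := norm_integral_pow_partialR_sub_prod_le hlaw hindep S hn u
  rw [← hz] at h2
  have h3 := mul_le_mul_of_nonneg_left (sqrt_mul_sum_le π hn0 S) (abs_nonneg u)
  rw [hgauss]
  calc _ = ‖c * (∫ ω, z ^ partialR ξ S n ω ∂P
            - ∏ i ∈ S, ((1 - z) * Real.exp (-n * π.real {i}) + z))
          + (∏ i ∈ S, bernoulliCharFun (b i) u
            - ∏ i ∈ S, Complex.exp ((-(u ^ 2 * (b i * (1 - b i)) / 2) : ℝ) : ℂ))‖ := by
        rw [mul_sub, hprod]
        congr 1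
        ring
    _ ≤ _ := by
        refine (norm_add_le _ _).trans ?_
        rw [norm_mul, hc1, one_mul]
        linarith

/-- Both sides of the finite-set estimate converge as `S` increases: the sums by summability, the
integral by dominated convergence, since the restricted count is eventually equal to the full one at
each sample point. -/
lemma norm_centered_R_sub_gaussian_le (hlaw : ∀ k, HasLaw (ξ k) π P)
    (hindep : iIndepFun ξ P) {n : ℕ} (hn : 0 < n) {u : ℝ} (hu : |u| ≤ 1) :
    ‖Complex.exp (((-(u * mu π n) : ℝ) : ℂ) * Complex.I)
        * ∫ ω, Complex.exp (u * Complex.I) ^ R ξ n ω ∂P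
      - Complex.exp ((-(u ^ 2 * sigma π n ^ 2 / 2) : ℝ) : ℂ)‖
    ≤ |u| * (√(depoissonError π n) * sigma π n) + 32 / n + 2 * |u| ^ 3 * sigma π n ^ 2 := by
  have hn0 : (0 : ℝ) ≤ n := n.cast_nonneg
  have hv : Tendsto (fun S : Finset ℕ+ => ∑ i ∈ S, occurrenceVar n (π.real {i})) atTop
    (𝓝 (sigma π n ^ 2)) := hasSum_occurrenceVar π hn0
  have hm : Tendsto (fun S : Finset ℕ+ => ∑ i ∈ S, (1 - Real.exp (-n * π.real {i}))) atTop
    (𝓝 (mu π n)) := (summable_mu π hn0).hasSum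
  have hI : Tendsto (fun S : Finset ℕ+ =>
      ∫ ω, Complex.exp (u * Complex.I) ^ partialR ξ S n ω ∂P) atTop
      (𝓝 (∫ ω, Complex.exp (u * Complex.I) ^ R ξ n ω ∂P)) := by
    refine tendsto_integral_filter_of_dominated_convergence (fun _ => 1)
      (.of_forall fun S => (integrable_pow_partialR (fun k => (hlaw k).aemeasurable) S n
        _).aestronglyMeasurable)
      (.of_forall fun S => .of_forall fun ω => ?_) (integrable_const _) (.of_forall fun ω => ?_)
    · rw [norm_pow, Complex.norm_exp_ofReal_mul_I, one_pow]
    · refine tendsto_const_nhds.congr' ?_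
      filter_upwards [eventually_partialR_eq_R ξ n ω] with S hS
      rw [hS]
  have hs : √(sigma π n ^ 2) = sigma π n := Real.sqrt_sq (Real.sqrt_nonneg _)
  have hL := (((Complex.continuous_exp.tendsto _).comp
    (((Complex.continuous_ofReal.tendsto _).comp (hm.const_mul u).neg).mul_const
      Complex.I)).mul hI).sub ((Complex.continuous_exp.tendsto _).comp
        ((Complex.continuous_ofReal.tendsto _).comp ((hv.const_mul (u ^ 2)).div_const 2).neg))
  have hR := ((((Real.continuous_sqrt.tendsto _).comp hv).const_mul
    (√(depoissonError π n))).const_mul |u|).add_const (32 / (n : ℝ)) |>.add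
      (hv.const_mul (2 * |u| ^ 3))
  rw [hs] at hR
  exact le_of_tendsto_of_tendsto' hL.norm hR fun S =>
    norm_centered_partialR_sub_gaussian_le hlaw hindep S hn hu

end

end RangeRenewal

theorem theorem1p1
    (π : Measure ℕ+) [IsProbabilityMeasure π]
    (hpos : ∀ i : ℕ+, 0 < π {i})
    (hanti : ∀ i : ℕ+, π {i + 1} ≤ π {i})
    {Ω : Type*} [MeasurableSpace Ω] (P : Measure Ω) [IsProbabilityMeasure P]
    (ξ : ℕ → Ω → ℕ+)
    (hlaw : ∀ k : ℕ, HasLaw (ξ k) π P)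
    (hindep : iIndepFun ξ P)
    (hσ : Tendsto (fun n : ℕ => RangeRenewal.sigma π n) atTop atTop) :
    TendstoInDistribution
      (fun (n : ℕ) (ω : Ω) =>
        ((RangeRenewal.R ξ n ω : ℝ) - RangeRenewal.mu π n) / RangeRenewal.sigma π n)
      atTop (id : ℝ → ℝ) (fun _ => P) (gaussianReal 0 1) := by
  have hξ := fun k => (hlaw k).aemeasurable
  refine ⟨fun n => ((RangeRenewal.aemeasurable_R hξ n).sub_const _).div_const _,
    aemeasurable_id, ProbabilityMeasure.tendsto_of_tendsto_charFun fun θ => ?_⟩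
  simp only [ProbabilityMeasure.coe_mk, Measure.map_id]
  rw [charFun_gaussianReal]
  simp_rw [RangeRenewal.charFun_normalized_R_eq hξ]
  rw [tendsto_iff_norm_sub_tendsto_zero]
  -- These are the three error terms at `u = θ / σ_n`, after cancelling powers of `σ_n`.
  have hbound : Tendsto (fun n : ℕ => |θ| * √(RangeRenewal.depoissonError π n) + 32 / (n : ℝ)
      + 2 * |θ| ^ 3 * (RangeRenewal.sigma π n)⁻¹) atTop (nhds 0) := by
    have h1 := (((Real.continuous_sqrt.tendsto _).comp
      (RangeRenewal.tendsto_depoissonError π)).const_mul |θ|).add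
      (tendsto_const_div_atTop_nhds_zero_nat (32 : ℝ)) |>.add
      ((tendsto_inv_atTop_zero.comp hσ).const_mul (2 * |θ| ^ 3))
    simpa using h1
  refine squeeze_zero' (.of_forall fun _ => norm_nonneg _) ?_ hbound
  filter_upwards [hσ.eventually_ge_atTop |θ|, hσ.eventually_gt_atTop 0, eventually_gt_atTop 0]
    with n h1 h2 hn
  have hu : |θ / RangeRenewal.sigma π n| ≤ 1 := by
    rw [abs_div, abs_of_pos h2]
    exact div_le_one_of_le₀ h1 h2.le
  have h3 := RangeRenewal.norm_centered_R_sub_gaussian_le hlaw hindep hn hu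
  rw [abs_div, abs_of_pos h2] at h3
  have e1 : (((-((θ / RangeRenewal.sigma π n) ^ 2 * RangeRenewal.sigma π n ^ 2 / 2) : ℝ)) : ℂ)
      = θ * (0 : ℝ) * Complex.I - ((1 : NNReal) : ℝ) * θ ^ 2 / 2 := by
    rw [div_pow, div_mul_cancel₀ _ (pow_ne_zero 2 h2.ne')]
    push_cast
    ring
  rw [e1] at h3
  refine h3.trans_eq ?_
  field_simp
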